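/- There is a function $P$ on $[0,\infty)$ of the form $P(x)=\sum_{k=1}^{m} c_k x^{a_k}$ (a finite sum with absolute real constants $c_k$ and real exponents $a_k\in(0,1)$, so that $P(x)\to0$ as $x\to0^+$; such a function is denoted $\mathrm{poly}_{<1}$) for which the following holds. Let $V$ be a vertex set and consider any 2-round Lasserre solution on $V$: vectors $\mathbf v_{T,\alpha}$ in a finite-dimensional real inner product space, for $T\subseteq V$, $|T|\le2$, $\alpha\in\{0,1\}^T$, together with consistent local distributions of random assignments $X_T\in\{0,1\}^T$, $|T|\le 2$, such that $\langle\mathbf v_{T,\alpha},\mathbf v_{U,\beta}\rangle=\Pr[X_T=\alpha,X_U=\beta]$ whenever $|T\cup U|\le2$. For $i\in V$ put $\mu_i=2\,\mathbf E[X_i]-1$ and $\mathbf v_i=\mathbf v_{i,1}-\mathbf v_{i,0}$; let $\mathbf w_i$ be the component of $\mathbf v_i$ orthogonal to the unit vector $\mathbf v_\emptyset$, and $\overline{\mathbf w}_i=\mathbf w_i/\|\mathbf w_i\|$ (with $\overline{\mathbf w}_i=0$ if $\mathbf w_i=0$). Round this solution as follows. Let $f_R(x)=0.79\,x+0.07\,x^3+0.14\,x^7$.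 Draw a standard Gaussian vector $\mathbf g$ in the orthogonal complement of $\mathbf v_\emptyset$, and for each $i\in V$ let $\xi_i=\langle\mathbf g,\overline{\mathbf w}_i\rangle$ and $r_i=f_R(\mu_i)$. Set $y_i=1$ if $\xi_i\le\Phi^{-1}(r_i/2+1/2)$ and $y_i=-1$ otherwise, where $\Phi$ is the distribution function of $\mathcal N(0,1)$, $\Phi^{-1}(0)=-\infty$ and $\Phi^{-1}(1)=+\infty$. If $(i_1,i_2)$ and $(j_1,j_2)$ are two pairs of vertices (in particular, two edges) and $\delta$ is a real number with $$|\langle\mathbf w_{i_1},\mathbf w_{j_1}\rangle|+|\langle\mathbf w_{i_1},\mathbf w_{j_2}\rangle|+|\langle\mathbf w_{i_2},\mathbf w_{j_1}\rangle|+|\langle\mathbf w_{i_2},\mathbf w_{j_2}\rangle|\le\delta,$$ then $$I(y_{i_1}y_{i_2};\,y_{j_1}y_{j_2})\le P(\delta),$$ where $I(X;Y)=\sum_{a,b}\Pr[X=a,Y=b]\log_2\frac{\Pr[X=a,Y=b]}{\Pr[X=a]\Pr[Y=b]}$ is the mutual information, terms with $\Pr[X=a,Y=b]=0$ being $0$.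 -/

import Mathlib

open MeasureTheory ProbabilityTheory Filter Topology

namespace SimMaxCut

/-! ### Information theory -/

/-- Mutual information (in bits) of two finitely valued random variables,
`I(X;Y) = ∑ Pr[X=a,Y=b] log (Pr[X=a,Y=b] / (Pr[X=a] Pr[Y=b]))`, where terms with
`Pr[X=a,Y=b] = 0` are zero. -/
noncomputable def mutualInfo {Ω A B : Type*} [MeasurableSpace Ω] [Fintype A] [Fintype B]
    (P : Measure Ω) (X : Ω → A) (Y : Ω → B) : ℝ :=
  ∑ a : A, ∑ b : B, P.real {ω | X ω = a ∧ Y ω = b} *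
    Real.logb 2 (P.real {ω | X ω = a ∧ Y ω = b} /
      (P.real {ω | X ω = a} * P.real {ω | Y ω = b}))

/-! ### Lasserre solutions -/

/-- An `r`-round Lasserre vector solution on the vertex set `V`: vectors `v_{T,α}` for
`T ⊆ V`, `|T| ≤ r`, `α ∈ {0,1}^T`, together with consistent local distributions of random
assignments `X_T`, `|T| ≤ r`, such that
`⟨v_{T,α}, v_{U,β}⟩ = Pr[X_T = α, X_U = β]` whenever `|T ∪ U| ≤ r`.
(Values at sets with more than `r` elements are irrelevant.) In particular the inner product
vanishes if `α` and `β` disagree on `T ∩ U`, `‖v_∅‖ = 1`, and `‖v_{T,α}‖² = ⟨v_{T,α}, v_∅⟩`. -/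
structure LasserreSolution (V : Type*) [DecidableEq V] (E : Type*) [NormedAddCommGroup E]
    [InnerProductSpace ℝ E] (r : ℕ) where
  vec : (T : Finset V) → (T → Bool) → E
  dist : (T : Finset V) → PMF (T → Bool)
  dist_consistent : ∀ (S T : Finset V) (h : S ⊆ T), T.card ≤ r →
    (dist T).map (Finset.restrict₂ (π := fun _ => Bool) h) = dist S
  inner_eq : ∀ (T U : Finset V), (T ∪ U).card ≤ r → ∀ (α : T → Bool) (β : U → Bool),
    inner ℝ (vec T α) (vec U β) =
      ((dist (T ∪ U)).map (fun ω =>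
        (Finset.restrict₂ (π := fun _ => Bool) Finset.subset_union_left ω,
         Finset.restrict₂ (π := fun _ => Bool) Finset.subset_union_right ω)) (α, β)).toReal

namespace LasserreSolution

variable {V : Type*} [DecidableEq V] {E : Type*} [NormedAddCommGroup E]
  [InnerProductSpace ℝ E] {r : ℕ}

/-- The vector `v_∅`. -/
def vEmpty (L : LasserreSolution V E r) : E := L.vec ∅ (fun _ => false)

/-- The bias `μ_i = 2 E[X_i] - 1`, where `E[X_i] = Pr[X_i = 1]` under the local distribution. -/
noncomputable def bias (L : LasserreSolution V E r) (i : V) : ℝ :=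
  2 * (L.dist {i} (fun _ => true)).toReal - 1

/-- `v_i = v_{i,1} - v_{i,0}`. -/
def v (L : LasserreSolution V E r) (i : V) : E :=
  L.vec {i} (fun _ => true) - L.vec {i} (fun _ => false)

/-- `w_i`, the component of `v_i` orthogonal to the unit vector `v_∅`. -/
noncomputable def w (L : LasserreSolution V E r) (i : V) : E :=
  L.v i - (inner ℝ (L.v i) L.vEmpty) • L.vEmpty

/-- The normalization of `w_i` (zero if `w_i = 0`, that is, if `μ_i = ± 1`). -/
noncomputable def wBar (L : LasserreSolution V E r) (i : V) : E :=
  ‖L.w i‖⁻¹ • L.w i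

end LasserreSolution

/-! ### The rounding procedure -/

/-- The rounding function. -/
noncomputable def fR (x : ℝ) : ℝ := 0.79 * x + 0.07 * x ^ 3 + 0.14 * x ^ 7

/-- `Φ⁻¹ : [0,1] → [-∞,∞]`, the inverse of the distribution function `Φ` of `N(0,1)`, with
`Φ⁻¹(0) = -∞` and `Φ⁻¹(1) = +∞`. -/
noncomputable def PhiInv (p : ℝ) : EReal :=
  sInf ((fun x : ℝ => (x : EReal)) '' {x : ℝ | p ≤ cdf (gaussianReal 0 1) x})

namespace LasserreSolution

variable {V : Type*} [DecidableEq V] {E : Type*} [NormedAddCommGroup E]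
  [InnerProductSpace ℝ E] {r : ℕ}

/-- The subspace of vectors orthogonal to `v_∅`, in which the Gaussian vector is drawn. -/
noncomputable def gaussSpace (L : LasserreSolution V E r) : Submodule ℝ E :=
  (Submodule.span ℝ {L.vEmpty})ᗮ

open Classical in
/-- The rounded value `y_i ∈ {1,-1}` as a function of the drawn vector `g`: with
`ξ_i = ⟨g, w̄_i⟩` and `r_i = f_R(μ_i)`, `y_i = 1` if `ξ_i ≤ Φ⁻¹(r_i/2 + 1/2)`, and
`y_i = -1` otherwise. -/
noncomputable def y (L : LasserreSolution V E r) (i : V) (g : L.gaussSpace) : ℤˣ :=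
  if ((inner ℝ (g : E) (L.wBar i) : ℝ) : EReal) ≤ PhiInv (fR (L.bias i) / 2 + 1 / 2)
  then 1 else -1

end LasserreSolution

/-! ### Polynomials with exponents in `(0,1)` -/

/-- `P` is, on `[0,∞)`, a finite sum `∑ c_a x^a` with real exponents `a ∈ (0,1)`, and
`P(x) → 0` as `x → 0⁺`. -/
def IsPolyLTOne (P : ℝ → ℝ) : Prop :=
  (∃ c : ℝ →₀ ℝ, (∀ a ∈ c.support, 0 < a ∧ a < 1) ∧
    ∀ x : ℝ, 0 ≤ x → P x = ∑ a ∈ c.support, c a * x ^ a) ∧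
  Tendsto P (𝓝[>] 0) (𝓝 0)

end SimMaxCut

namespace SimMaxCut

/-! ### Mutual information and deviation from independence -/

/-! If the four cross inner products vanished for the normals `w̄`, the Gaussian coordinates of the
two pairs would be uncorrelated, hence independent, and so would the two products. The proof is a
quantitative perturbation of this case. Choose `τ` with the sum of the inner products at most `τ ^
12`.

A vector `w_i` shorter than `τ ^ 3` spoils normalization, but then `μ_i` is near `±1`, and since
`fR` fixes `±1` the value `y_i` is constant outside probability `τ ^ 6` (`exists_y_ne_const_le`);
its normal is replaced by zero. The remaining normalized inner products are at most `τ ^ 12 / (τ ^ 3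
* τ ^ 3) = τ ^ 6`, and moving the normals by at most `3 * τ ^ 3` makes the pairs exactly orthogonal
(`exists_near_orthogonal`). Each sign then changes with probability `O(τ ^ 2)`
(`stdGaussian_halfspaceSign_ne_le`), so joint and product laws differ by `O(τ ^ 2)`. Mutual
information costs a square root (`mutualInfo_units_le`), which leaves `192 * τ`, with `τ = δ ^ (1 /
12)`. -/

lemma mul_logb_div_le {p a b e : ℝ} (hp : 0 ≤ p) (hpa : p ≤ a) (hpb : p ≤ b)
    (he : |p - a * b| ≤ e) : p * Real.logb 2 (p / (a * b)) ≤ 4 * √e := by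
  have hq : 0 ≤ a * b := mul_nonneg (hp.trans hpa) (hp.trans hpb)
  have hlog2 : (1 / 2 : ℝ) < Real.log 2 := by linarith [Real.log_two_gt_d9]
  have hsq := Real.sqrt_nonneg e
  rcases le_or_gt p (a * b) with h | h
  · have : Real.logb 2 (p / (a * b)) ≤ 0 :=
      div_nonpos_of_nonpos_of_nonneg
        (Real.log_nonpos (div_nonneg hp hq) (div_le_one_of_le₀ h hq)) (by linarith)
    nlinarith
  · have hp0 : 0 < p := hq.trans_lt h
    have hpq : p ^ 2 ≤ a * b := by nlinarith
    have hq0 : 0 < a * b := lt_of_lt_of_le (by positivity) hpq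
    set q := a * b with hqdef
    -- Writing the logarithm as `2 log u` before using `log u ≤ u - 1` makes `p ^ 2 ≤ q` enough to
    -- absorb the division by `q`; no lower bound on the marginals is needed.
    set u := √(p / q) with hu
    have hu2 : u ^ 2 = p / q := Real.sq_sqrt (by positivity)
    have hu0 : 0 < u := Real.sqrt_pos.2 (by positivity)
    have hu1 : 1 ≤ u := by
      rw [hu, Real.one_le_sqrt, one_le_div hq0]; exact h.le
    have hlog : Real.log (p / q) ≤ 2 * (u - 1) := by
      rw [← hu2, Real.log_pow]
      have := Real.log_le_sub_one_of_pos hu0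
      push_cast; linarith
    have hmain : p * (u - 1) ≤ √e := by
      refine Real.le_sqrt_of_sq_le ?_
      have h1 : (u - 1) ^ 2 ≤ (p - q) / q := by
        have : (p - q) / q = u ^ 2 - 1 := by rw [hu2]; field_simp
        rw [this]; nlinarith
      calc (p * (u - 1)) ^ 2 = p ^ 2 * (u - 1) ^ 2 := by ring
        _ ≤ q * ((p - q) / q) := mul_le_mul hpq h1 (sq_nonneg _) hq
        _ = p - q := by field_simp
        _ ≤ e := (le_abs_self _).trans he
    have hlog' : p * Real.log (p / q) ≤ 2 * √e := by nlinarith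
    rw [Real.logb, ← mul_div_assoc, div_le_iff₀ (by linarith)]
    nlinarith

lemma mutualInfo_units_le {Ω : Type*} [MeasurableSpace Ω] (P : Measure Ω) [IsProbabilityMeasure P]
    (X Y : Ω → ℤˣ) {e : ℝ}
    (h : ∀ a b, |P.real {ω | X ω = a ∧ Y ω = b} -
      P.real {ω | X ω = a} * P.real {ω | Y ω = b}| ≤ e) :
    mutualInfo P X Y ≤ 16 * √e := by
  have h1 : mutualInfo P X Y ≤ ∑ _a : ℤˣ, ∑ _b : ℤˣ, 4 * √e :=
    Finset.sum_le_sum fun a _ => Finset.sum_le_sum fun b _ =>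
      mul_logb_div_le measureReal_nonneg (measureReal_mono fun ω hω => hω.1)
        (measureReal_mono fun ω hω => hω.2) (h a b)
  refine h1.trans (le_of_eq ?_)
  simp; ring

lemma abs_measureReal_sub_le {Ω : Type*} [MeasurableSpace Ω] (P : Measure Ω)
    [IsProbabilityMeasure P] {S T U : Set Ω} (h₁ : S ⊆ T ∪ U) (h₂ : T ⊆ S ∪ U) :
    |P.real S - P.real T| ≤ P.real U := by
  have := (measureReal_mono h₁ (μ := P)).trans (measureReal_union_le T U)
  have := (measureReal_mono h₂ (μ := P)).trans (measureReal_union_le S U)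
  rw [abs_le]; constructor <;> linarith

lemma measureReal_ne_trans_le {Ω A : Type*} [MeasurableSpace Ω] (P : Measure Ω)
    [IsProbabilityMeasure P] (f g h : Ω → A) :
    P.real {ω | f ω ≠ h ω} ≤ P.real {ω | f ω ≠ g ω} + P.real {ω | g ω ≠ h ω} := by
  refine (measureReal_mono fun ω hω => ?_).trans (measureReal_union_le _ _)
  by_contra hc
  simp only [Set.mem_union, Set.mem_ofPred_eq, not_or, not_not] at hc
  exact hω (hc.1.trans hc.2)

/-- Changing two random variables into independent ones on an event of probability `ε` shows
that the original ones are nearly independent. -/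
lemma abs_joint_sub_mul_le {Ω A B : Type*} [MeasurableSpace Ω]
    [MeasurableSpace A] [MeasurableSingletonClass A] [MeasurableSpace B]
    [MeasurableSingletonClass B] (P : Measure Ω) [IsProbabilityMeasure P]
    {X X' : Ω → A} {Y Y' : Ω → B} (hind : IndepFun X' Y' P) {ε : ℝ}
    {U : Set Ω} (hX : ∀ ω ∉ U, X ω = X' ω) (hY : ∀ ω ∉ U, Y ω = Y' ω) (hU : P.real U ≤ ε)
    (a : A) (b : B) :
    |P.real {ω | X ω = a ∧ Y ω = b} - P.real {ω | X ω = a} * P.real {ω | Y ω = b}| ≤ 3 * ε := by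
  have key : ∀ (p q : Ω → Prop), (∀ ω ∉ U, p ω ↔ q ω) →
      |P.real {ω | p ω} - P.real {ω | q ω}| ≤ ε := fun p q hpq =>
    (abs_measureReal_sub_le P
      (fun ω hω => by by_cases h : ω ∈ U; exacts [Or.inr h, Or.inl ((hpq ω h).1 hω)])
      (fun ω hω => by by_cases h : ω ∈ U; exacts [Or.inr h, Or.inl ((hpq ω h).2 hω)])).trans hU
  have h1 := key (fun ω => X ω = a ∧ Y ω = b) (fun ω => X' ω = a ∧ Y' ω = b)
    fun ω h => by rw [hX ω h, hY ω h]
  have h2 := key (fun ω => X ω = a) (fun ω => X' ω = a) fun ω h => by rw [hX ω h]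
  have h3 := key (fun ω => Y ω = b) (fun ω => Y' ω = b) fun ω h => by rw [hY ω h]
  have h4 : P.real {ω | X' ω = a ∧ Y' ω = b} = P.real {ω | X' ω = a} * P.real {ω | Y' ω = b} := by
    have := hind.measure_inter_preimage_eq_mul {a} {b} (measurableSet_singleton a)
      (measurableSet_singleton b)
    have := congrArg ENNReal.toReal this
    rwa [ENNReal.toReal_mul] at this
  have h5 : P.real {ω | X ω = a} ≤ 1 := measureReal_le_one
  have h5' : 0 ≤ P.real {ω | X ω = a} := measureReal_nonneg
  have h6 : P.real {ω | Y' ω = b} ≤ 1 := measureReal_le_one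
  have h6' : 0 ≤ P.real {ω | Y' ω = b} := measureReal_nonneg
  rw [h4] at h1
  -- The error `ε` enters three times: for the joint event and for each of the two marginals.
  rw [abs_le] at *
  constructor <;> nlinarith

/-! ### Gaussian halfspaces -/

section Gaussian

variable {F : Type*} [NormedAddCommGroup F] [InnerProductSpace ℝ F]

open Classical in
/-- The `±1`-valued indicator of the halfspace `⟨g, a⟩ ≤ t`. -/
noncomputable def halfspaceSign (a : F) (t : EReal) (g : F) : ℤˣ :=
  if ((inner ℝ g a : ℝ) : EReal) ≤ t then 1 else -1

variable [FiniteDimensional ℝ F] [MeasurableSpace F] [BorelSpace F]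

lemma map_inner_stdGaussian (a : F) :
    (stdGaussian F).map (fun g => inner ℝ g a) = gaussianReal 0 (‖a‖ ^ 2).toNNReal := by
  have h := IsGaussian.map_eq_gaussianReal (μ := stdGaussian F) (innerSL ℝ a)
  rw [integral_strongDual_stdGaussian, variance_dual_stdGaussian] at h
  rw [innerSL_apply_norm] at h
  rw [← h]
  congr 1
  ext g
  simp [real_inner_comm]

instance : MeasurableSingletonClass ℤˣ where
  measurableSet_singleton u :=
    ⟨{(u : ℤ)}, measurableSet_singleton _, by ext v; simp [Units.ext_iff]⟩

lemma measurable_halfspaceSign (t : EReal) :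
    Measurable fun x : ℝ => (if (x : EReal) ≤ t then (1 : ℤˣ) else -1) :=
  Measurable.ite (measurableSet_le measurable_coe_real_ereal measurable_const)
    measurable_const measurable_const

lemma stdGaussian_abs_inner_ge (a : F) {s : ℝ} (hs : 0 < s) :
    (stdGaussian F).real {g | s ≤ |inner ℝ g a|} ≤ ‖a‖ ^ 2 / s ^ 2 := by
  have hmem : MemLp (innerSL ℝ a) 2 (stdGaussian F) :=
    IsGaussian.memLp_dual _ _ 2 (by simp)
  have h := meas_ge_le_variance_div_sq hmem hs
  rw [integral_strongDual_stdGaussian, variance_dual_stdGaussian, innerSL_apply_norm] at h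
  have := ENNReal.toReal_mono ENNReal.ofReal_ne_top h
  rw [ENNReal.toReal_ofReal (by positivity)] at this
  simpa [Measure.real, real_inner_comm] using this

/-- The standard normal density is at most `1 / √(2π) < 1`. -/
lemma gaussianReal_le_volume (S : Set ℝ) : gaussianReal 0 1 S ≤ volume S := by
  rw [gaussianReal_apply 0 one_ne_zero]
  calc ∫⁻ x in S, gaussianPDF 0 1 x ≤ ∫⁻ x in S, 1 := by
        refine lintegral_mono fun x => ?_
        rw [gaussianPDF, ENNReal.ofReal_le_one, gaussianPDFReal_def]
        refine mul_le_one₀ (inv_le_one_of_one_le₀ ?_) (Real.exp_nonneg _) ?_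
        · rw [Real.one_le_sqrt]
          have := Real.pi_gt_three
          simp only [NNReal.coe_one]; linarith
        · rw [Real.exp_le_one_iff]
          simp only [NNReal.coe_one]
          exact div_nonpos_of_nonpos_of_nonneg (neg_nonpos.2 (sq_nonneg _)) (by norm_num)
    _ = volume S := by simp

lemma stdGaussian_abs_inner_sub_le {a : F} (ha : ‖a‖ = 1) (t : ℝ) {s : ℝ} (hs : 0 ≤ s) :
    (stdGaussian F).real {g | |inner ℝ g a - t| ≤ s} ≤ 2 * s := by
  have h : stdGaussian F {g | |inner ℝ g a - t| ≤ s} =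
      gaussianReal 0 1 (Metric.closedBall t s) := by
    have := map_inner_stdGaussian a
    rw [ha] at this
    simp only [one_pow, Real.toNNReal_one] at this
    rw [← this, Measure.map_apply (by fun_prop) measurableSet_closedBall]
    rfl
  rw [Measure.real, h]
  refine ENNReal.toReal_le_of_le_ofReal (by positivity) ((gaussianReal_le_volume _).trans ?_)
  rw [Real.volume_closedBall]

/-- A halfspace with a unit normal vector changes little if its normal vector does. -/
lemma stdGaussian_halfspaceSign_ne_le {a a' : F} (h : ‖a‖ = 1 ∨ a = a') (t : EReal) {s : ℝ}
    (hs : 0 < s) :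
    (stdGaussian F).real {g | halfspaceSign a t g ≠ halfspaceSign a' t g} ≤
      2 * s + ‖a - a'‖ ^ 2 / s ^ 2 := by
  have hnn : 0 ≤ 2 * s + ‖a - a'‖ ^ 2 / s ^ 2 := by positivity
  rcases h with ha | rfl
  swap
  · simpa using hnn
  induction t with
  | bot => simpa [halfspaceSign] using hnn
  | top => simpa [halfspaceSign] using hnn
  | coe t =>
    -- The signs can differ only if `⟨g, a⟩` lies within `s` of the threshold (density bound) or the
    -- perturbation moves it by at least `s` (Chebyshev). The second normal need not be a unit
    -- vector.
    have hsub : {g | halfspaceSign a t g ≠ halfspaceSign a' t g} ⊆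
        {g : F | |inner ℝ g a - t| ≤ s} ∪ {g | s ≤ |inner ℝ g (a - a')|} := by
      intro g hg
      by_contra hc
      simp only [Set.mem_union, Set.mem_ofPred_eq, not_or, not_le, inner_sub_right] at hc
      refine hg ?_
      obtain ⟨h1, h2⟩ := hc
      simp only [halfspaceSign, EReal.coe_le_coe_iff]
      rw [abs_lt] at h2
      rcases lt_abs.1 h1 with h1 | h1
      · rw [if_neg (by linarith), if_neg (by linarith)]
      · rw [if_pos (by linarith), if_pos (by linarith)]
    exact ((measureReal_mono hsub).trans (measureReal_union_le _ _)).trans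
      (add_le_add (stdGaussian_abs_inner_sub_le ha t hs.le) (stdGaussian_abs_inner_ge _ hs))

/-- Pairs of halfspaces with mutually orthogonal normal vectors are independent. -/
lemma indepFun_halfspaceSign {a₁ a₂ b₁ b₂ : F} (h₁₁ : inner ℝ a₁ b₁ = 0)
    (h₁₂ : inner ℝ a₁ b₂ = 0) (h₂₁ : inner ℝ a₂ b₁ = 0) (h₂₂ : inner ℝ a₂ b₂ = 0)
    (s₁ s₂ t₁ t₂ : EReal) :
    IndepFun (fun g => halfspaceSign a₁ s₁ g * halfspaceSign a₂ s₂ g)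
      (fun g => halfspaceSign b₁ t₁ g * halfspaceSign b₂ t₂ g) (stdGaussian F) := by
  have hcov : ∀ a b : F, inner ℝ a b = 0 →
      cov[fun g => innerSL ℝ a g, fun g => innerSL ℝ b g; stdGaussian F] = 0 := by
    intro a b hab
    have := covarianceBilin_apply_eq_cov (μ := stdGaussian F)
      (IsGaussian.memLp_two_id) a b
    rw [covarianceBilin_stdGaussian] at this
    rw [innerSL_apply_apply, hab] at this
    exact this.symm
  have hind : IndepFun (fun g (k : Fin 2) => innerSL ℝ (![a₁, a₂] k) g)
      (fun g (k : Fin 2) => innerSL ℝ (![b₁, b₂] k) g) (stdGaussian F) := by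
    refine HasGaussianLaw.indepFun_of_covariance_eval ?_ ?_
    · exact (IsGaussian.hasGaussianLaw_id (μ := stdGaussian F)).map_fun
        ((ContinuousLinearMap.pi fun k => innerSL ℝ (![a₁, a₂] k)).prod
          (ContinuousLinearMap.pi fun k => innerSL ℝ (![b₁, b₂] k)))
    · intro i j
      fin_cases i <;> fin_cases j <;> exact hcov _ _ (by assumption)
  let φ : EReal → EReal → (Fin 2 → ℝ) → ℤˣ := fun s t x =>
    (if (x 0 : EReal) ≤ s then 1 else -1) * (if (x 1 : EReal) ≤ t then 1 else -1)
  have hφ : ∀ s t, Measurable (φ s t) := fun s t =>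
    (measurable_of_countable fun p : ℤˣ × ℤˣ => p.1 * p.2).comp
      (((measurable_halfspaceSign s).comp (measurable_pi_apply 0)).prodMk
        ((measurable_halfspaceSign t).comp (measurable_pi_apply 1)))
  have := hind.comp (hφ s₁ s₂) (hφ t₁ t₂)
  convert this using 1 <;> ext g <;> simp [φ, halfspaceSign, real_inner_comm]

end Gaussian

/-! ### Decoupling nearly orthogonal pairs of vectors -/

section Geometry

variable {F : Type*} [NormedAddCommGroup F] [InnerProductSpace ℝ F]

lemma inner_sub_smul_self_right {b : F} (hb : ‖b‖ = 1 ∨ b = 0) (a : F) :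
    inner ℝ (a - (inner ℝ a b : ℝ) • b) b = 0 := by
  rcases hb with hb | rfl
  · rw [inner_sub_left, real_inner_smul_left, real_inner_self_eq_norm_sq, hb]; ring
  · simp

/-- If `b₁` is a unit vector (or zero) and `b₂` has norm at most one, then after a small change
of `b₂`, all vectors nearly orthogonal to `b₁, b₂` are close to vectors orthogonal to them. -/
lemma exists_near_orthogonal {b₁ b₂ : F} (h₁ : ‖b₁‖ = 1 ∨ b₁ = 0) (h₂ : ‖b₂‖ ≤ 1) {τ : ℝ}
    (hτ : 0 < τ) (hτ1 : τ ≤ 1) :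
    ∃ b₂' : F, ‖b₂ - b₂'‖ ≤ 3 * τ ^ 3 ∧ (b₂ = 0 → b₂' = 0) ∧
      ∀ a : F, |inner ℝ a b₁| ≤ τ ^ 6 → |inner ℝ a b₂| ≤ τ ^ 6 →
        ∃ a' : F, ‖a - a'‖ ≤ 3 * τ ^ 3 ∧ (a = 0 → a' = 0) ∧
          inner ℝ a' b₁ = 0 ∧ inner ℝ a' b₂' = 0 := by
  have hτ3 : 0 < τ ^ 3 := by positivity
  have hτ36 : τ ^ 6 ≤ τ ^ 3 := pow_le_pow_of_le_one hτ.le hτ1 (by norm_num)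
  have hn₁ : ‖b₁‖ ≤ 1 := by rcases h₁ with h | rfl <;> simp [*]
  set c := b₂ - (inner ℝ b₂ b₁ : ℝ) • b₁ with hc
  have hproj : ∀ a : F, |inner ℝ a b₁| ≤ τ ^ 6 → ‖(inner ℝ a b₁ : ℝ) • b₁‖ ≤ τ ^ 6 := by
    intro a ha
    rw [norm_smul, Real.norm_eq_abs]
    calc _ ≤ τ ^ 6 * 1 := mul_le_mul ha hn₁ (norm_nonneg _) (by positivity)
      _ = _ := mul_one _
  -- Gram–Schmidt is unstable when `b₂` is nearly parallel to `b₁`. In that case `b₂` is replaced by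
  -- its projection onto `b₁`, leaving a single direction to remove; otherwise dividing by `‖c‖ > τ
  -- ^ 3` costs only `2 * τ ^ 6 / τ ^ 3`.
  rcases le_or_gt ‖c‖ (τ ^ 3) with hsmall | hbig
  · refine ⟨(inner ℝ b₂ b₁ : ℝ) • b₁, by rw [← hc]; linarith, fun h => by simp [h],
      fun a ha₁ ha₂ => ⟨a - (inner ℝ a b₁ : ℝ) • b₁, ?_, fun h => by simp [h],
        inner_sub_smul_self_right h₁ a, ?_⟩⟩
    · rw [sub_sub_cancel]
      linarith [hproj a ha₁]
    · rw [real_inner_smul_right, inner_sub_smul_self_right h₁ a, mul_zero]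
  · have hc0 : 0 < ‖c‖ := hτ3.trans hbig
    have hcb : inner ℝ c b₁ = 0 := inner_sub_smul_self_right h₁ b₂
    refine ⟨b₂, by simpa using hτ3.le, id, fun a ha₁ ha₂ =>
      ⟨a - (inner ℝ a b₁ : ℝ) • b₁ - ((inner ℝ a c : ℝ) / ‖c‖ ^ 2) • c, ?_, fun h => by simp [h],
        ?_⟩⟩
    · have hac : |inner ℝ a c| ≤ 2 * τ ^ 6 := by
        rw [hc, inner_sub_right, real_inner_smul_right]
        have h1 : |inner ℝ b₂ b₁| ≤ 1 := (abs_real_inner_le_norm _ _).trans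
          (mul_le_one₀ h₂ (norm_nonneg _) hn₁)
        calc _ ≤ |inner ℝ a b₂| + |inner ℝ b₂ b₁ * inner ℝ a b₁| := abs_sub _ _
          _ ≤ τ ^ 6 + 1 * τ ^ 6 := by
            rw [abs_mul]
            exact add_le_add ha₂ (mul_le_mul h1 ha₁ (abs_nonneg _) zero_le_one)
          _ = _ := by ring
      have h2 : ‖((inner ℝ a c : ℝ) / ‖c‖ ^ 2) • c‖ ≤ 2 * τ ^ 3 := by
        rw [norm_smul, norm_div, Real.norm_eq_abs, norm_pow, norm_norm]
        have : |inner ℝ a c| / ‖c‖ ^ 2 * ‖c‖ = |inner ℝ a c| / ‖c‖ := by field_simp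
        rw [this, div_le_iff₀ hc0]
        nlinarith
      have h3 : a - (a - (inner ℝ a b₁ : ℝ) • b₁ - ((inner ℝ a c : ℝ) / ‖c‖ ^ 2) • c) =
          (inner ℝ a b₁ : ℝ) • b₁ + ((inner ℝ a c : ℝ) / ‖c‖ ^ 2) • c := by abel
      rw [h3]
      linarith [norm_add_le ((inner ℝ a b₁ : ℝ) • b₁) (((inner ℝ a c : ℝ) / ‖c‖ ^ 2) • c),
        hproj a ha₁]
    · have e1 : inner ℝ (a - (inner ℝ a b₁ : ℝ) • b₁ - ((inner ℝ a c : ℝ) / ‖c‖ ^ 2) • c) b₁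
          = 0 := by
        rw [inner_sub_left, inner_sub_smul_self_right h₁ a, real_inner_smul_left, hcb]; ring
      refine ⟨e1, ?_⟩
      have e2 : b₂ = c + (inner ℝ b₂ b₁ : ℝ) • b₁ := by rw [hc]; abel
      have e3 : inner ℝ (a - (inner ℝ a b₁ : ℝ) • b₁ - ((inner ℝ a c : ℝ) / ‖c‖ ^ 2) • c) c
          = 0 := by
        rw [inner_sub_left, inner_sub_left, real_inner_smul_left, real_inner_smul_left,
          real_inner_self_eq_norm_sq, real_inner_comm c b₁, hcb]
        field_simp; ring
      calc _ = inner ℝ (a - (inner ℝ a b₁ : ℝ) • b₁ - ((inner ℝ a c : ℝ) / ‖c‖ ^ 2) • c)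
            (c + (inner ℝ b₂ b₁ : ℝ) • b₁) := by rw [← e2]
        _ = 0 := by rw [inner_add_right, e3, real_inner_smul_right, e1]; ring

end Geometry

/-! ### The quantile function -/

lemma gaussianReal_le_PhiInv {p : ℝ} (h0 : 0 ≤ p) (h1 : p ≤ 1) :
    (gaussianReal 0 1).real {x : ℝ | (x : EReal) ≤ PhiInv p} = p := by
  have hlt : ∀ x : ℝ, (x : EReal) < PhiInv p → cdf (gaussianReal 0 1) x < p := by
    intro x hx
    by_contra hc
    exact not_le.2 hx (sInf_le ⟨x, not_lt.1 hc, rfl⟩)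
  have hgt : ∀ x : ℝ, PhiInv p < x → p ≤ cdf (gaussianReal 0 1) x := by
    intro x hx
    obtain ⟨_, ⟨y, hy, rfl⟩, hyx⟩ := sInf_lt_iff.1 hx
    exact le_trans hy (monotone_cdf _ (EReal.coe_le_coe_iff.1 hyx.le))
  induction h : PhiInv p with
  | bot =>
    have : p ≤ 0 := ge_of_tendsto (tendsto_cdf_atBot (gaussianReal 0 1))
      (Eventually.of_forall fun x => hgt x (by rw [h]; exact EReal.bot_lt_coe x))
    simpa using le_antisymm h0 this
  | top =>
    have : 1 ≤ p := le_of_tendsto (tendsto_cdf_atTop (gaussianReal 0 1))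
      (Eventually.of_forall fun x => (hlt x (by rw [h]; exact EReal.coe_lt_top x)).le)
    simpa using le_antisymm this h1
  | coe t =>
    have hset : {x : ℝ | (x : EReal) ≤ (t : EReal)} = Set.Iic t := by ext; simp
    rw [hset, ← cdf_eq_real]
    refine le_antisymm ?_ ?_
    -- Absence of atoms bounds the distribution function at `t` by its left limit, which is at most
    -- `p`; right continuity gives the reverse inequality.
    · have hs := StieltjesFunction.measure_singleton (cdf (gaussianReal 0 1)) t
      have : NullSingletonClass (gaussianReal 0 1) := nullSingletonClass_gaussianReal one_ne_zero
      rw [measure_cdf, measure_singleton, eq_comm, ENNReal.ofReal_eq_zero, sub_nonpos] at hs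
      refine hs.trans (le_of_tendsto ((monotone_cdf _).tendsto_leftLim t) ?_)
      filter_upwards [self_mem_nhdsWithin] with x hx
      exact (hlt x (by rw [h]; exact EReal.coe_lt_coe_iff.2 hx)).le
    · refine ge_of_tendsto (((cdf (gaussianReal 0 1)).right_continuous t).mono_left
        (nhdsWithin_mono t Set.Ioi_subset_Ici_self)) ?_
      filter_upwards [self_mem_nhdsWithin] with x hx
      exact hgt x (by rw [h]; exact EReal.coe_lt_coe_iff.2 hx)

section Gaussian

variable {F : Type*} [NormedAddCommGroup F] [InnerProductSpace ℝ F]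
  [FiniteDimensional ℝ F] [MeasurableSpace F] [BorelSpace F]

lemma measurableSet_inner_le (a : F) (t : EReal) :
    MeasurableSet {g : F | ((inner ℝ g a : ℝ) : EReal) ≤ t} :=
  measurableSet_le (measurable_coe_real_ereal.comp (by fun_prop)) measurable_const

lemma stdGaussian_inner_le_PhiInv {a : F} (ha : ‖a‖ = 1) {p : ℝ} (h0 : 0 ≤ p) (h1 : p ≤ 1) :
    (stdGaussian F).real {g | ((inner ℝ g a : ℝ) : EReal) ≤ PhiInv p} = p := by
  have h := map_inner_stdGaussian a
  rw [ha] at h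
  simp only [one_pow, Real.toNNReal_one] at h
  conv_rhs => rw [← gaussianReal_le_PhiInv h0 h1, ← h]
  rw [map_measureReal_apply (by fun_prop)
    (measurableSet_le measurable_coe_real_ereal measurable_const)]
  rfl

lemma stdGaussian_halfspaceSign_ne_one {a : F} (ha : ‖a‖ = 1) {p : ℝ} (h0 : 0 ≤ p)
    (h1 : p ≤ 1) :
    (stdGaussian F).real {g | halfspaceSign a (PhiInv p) g ≠ 1} = 1 - p := by
  have h := measureReal_compl (μ := stdGaussian F) (measurableSet_inner_le a (PhiInv p))
  rw [stdGaussian_inner_le_PhiInv ha h0 h1, probReal_univ] at h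
  rw [← h]
  congr 1
  ext g
  by_cases hg : ((inner ℝ g a : ℝ) : EReal) ≤ PhiInv p
  · simp [halfspaceSign, hg]
  · simpa [halfspaceSign, hg] using not_le.1 hg

lemma stdGaussian_halfspaceSign_ne_neg_one {a : F} (ha : ‖a‖ = 1) {p : ℝ} (h0 : 0 ≤ p)
    (h1 : p ≤ 1) :
    (stdGaussian F).real {g | halfspaceSign a (PhiInv p) g ≠ -1} = p := by
  conv_rhs => rw [← stdGaussian_inner_le_PhiInv ha h0 h1]
  congr 1
  ext g
  by_cases hg : ((inner ℝ g a : ℝ) : EReal) ≤ PhiInv p <;> simp [halfspaceSign, hg]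

end Gaussian

/-! ### The rounding function -/

lemma fR_neg (x : ℝ) : fR (-x) = -fR x := by unfold fR; ring

/-- The coefficients sum to 1, and Bernoulli's inequality gives `1 - fR x ≤ 1.98 * (1 - x)`, where
`1.98 = 0.79 + 3 * 0.07 + 7 * 0.14`; finally `1 - x ≤ 1 - x ^ 2`. -/
lemma fR_bounds {x : ℝ} (h0 : 0 ≤ x) (h1 : x ≤ 1) :
    0 ≤ fR x ∧ fR x ≤ 1 ∧ 1 - fR x ≤ 2 * (1 - x ^ 2) := by
  have h3 := one_add_mul_le_pow (a := x - 1) (by linarith) 3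
  have h7 := one_add_mul_le_pow (a := x - 1) (by linarith) 7
  have h3' := pow_le_one₀ (n := 3) h0 h1
  have h7' := pow_le_one₀ (n := 7) h0 h1
  rw [add_sub_cancel] at h3 h7
  push_cast at h3 h7
  refine ⟨by unfold fR; positivity, ?_, ?_⟩ <;> unfold fR <;> nlinarith

/-! ### Geometry of Lasserre solutions -/

namespace LasserreSolution

variable {V : Type*} [DecidableEq V] {E : Type*} [NormedAddCommGroup E]
  [InnerProductSpace ℝ E] {r : ℕ}

/-- The assignment on `T` already determines its restriction to `U`, so the joint event is just `X_T
= α`. Consistency passes between the laws on `T ∪ U` and on `T`. -/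
lemma inner_vec_restrict (L : LasserreSolution V E r) {T U : Finset V} (hU : U ⊆ T)
    (hT : T.card ≤ r) (α : T → Bool) :
    inner ℝ (L.vec T α) (L.vec U (Finset.restrict₂ (π := fun _ => Bool) hU α)) =
      (L.dist T α).toReal := by
  have hTU : (T ∪ U).card ≤ r := by rwa [Finset.union_eq_left.2 hU]
  rw [L.inner_eq T U hTU, ← L.dist_consistent T (T ∪ U) Finset.subset_union_left hTU,
    PMF.map_apply, PMF.map_apply]
  congr 2
  ext ω
  congr 1
  rw [Prod.mk.injEq, eq_iff_iff, and_iff_left_iff_imp]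
  rintro rfl
  rfl

lemma inner_vec_of_ne (L : LasserreSolution V E r) {T : Finset V} (hT : T.card ≤ r)
    {α β : T → Bool} (h : α ≠ β) : inner ℝ (L.vec T α) (L.vec T β) = 0 := by
  rw [L.inner_eq T T (by rwa [Finset.union_self]), PMF.map_apply]
  have : ∀ ω : (T ∪ T : Finset V) → Bool, ¬ (α, β) =
      (Finset.restrict₂ (π := fun _ => Bool) Finset.subset_union_left ω,
        Finset.restrict₂ (π := fun _ => Bool) Finset.subset_union_right ω) := by
    intro ω hω
    rw [Prod.mk.injEq] at hω
    exact h (hω.1.trans hω.2.symm)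
  simp [this]

lemma inner_vec_self (L : LasserreSolution V E r) {T : Finset V} (hT : T.card ≤ r)
    (α : T → Bool) : inner ℝ (L.vec T α) (L.vec T α) = (L.dist T α).toReal :=
  L.inner_vec_restrict (Finset.Subset.refl T) hT α

lemma inner_vec_vEmpty (L : LasserreSolution V E r) {T : Finset V} (hT : T.card ≤ r)
    (α : T → Bool) : inner ℝ (L.vec T α) L.vEmpty = (L.dist T α).toReal := by
  rw [← L.inner_vec_restrict (Finset.empty_subset T) hT α, vEmpty]
  congr 2
  exact Subsingleton.elim _ _

lemma inner_vEmpty_self (L : LasserreSolution V E r) : inner ℝ L.vEmpty L.vEmpty = (1 : ℝ) := by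
  rw [vEmpty, L.inner_vec_self (by simp)]
  have := (L.dist ∅).tsum_coe
  rw [tsum_eq_single (fun _ => false) fun b hb => absurd (Subsingleton.elim _ _) hb] at this
  rw [this, ENNReal.toReal_one]

lemma dist_singleton_add (L : LasserreSolution V E r) (i : V) :
    (L.dist {i} fun _ => true).toReal + (L.dist {i} fun _ => false).toReal = 1 := by
  have := (L.dist {i}).tsum_coe
  rw [tsum_fintype, ← (Equiv.funUnique (({i} : Finset V) : Type _) Bool).symm.sum_comp,
    Fintype.sum_bool] at this
  rw [← ENNReal.toReal_add (PMF.apply_ne_top _ _) (PMF.apply_ne_top _ _), ← ENNReal.toReal_one,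
    ← this]
  rfl

lemma inner_v_self (L : LasserreSolution V E r) (hr : 1 ≤ r) (i : V) :
    inner ℝ (L.v i) (L.v i) = (1 : ℝ) := by
  have hne : (fun _ : (({i} : Finset V) : Type _) => true) ≠ fun _ => false :=
    fun h => by simpa using congrFun h ⟨i, by simp⟩
  have hc : ({i} : Finset V).card ≤ r := by simpa
  rw [v, inner_sub_left, inner_sub_right, inner_sub_right, L.inner_vec_self hc,
    L.inner_vec_self hc, L.inner_vec_of_ne hc hne, L.inner_vec_of_ne hc hne.symm]
  linarith [L.dist_singleton_add i]

lemma inner_v_vEmpty (L : LasserreSolution V E r) (hr : 1 ≤ r) (i : V) :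
    inner ℝ (L.v i) L.vEmpty = L.bias i := by
  have hc : ({i} : Finset V).card ≤ r := by simpa
  rw [v, inner_sub_left, L.inner_vec_vEmpty hc, L.inner_vec_vEmpty hc, bias]
  linarith [L.dist_singleton_add i]

/-- Pythagoras: `v_i` is a unit vector whose component along `v_∅` is `μ_i`. -/
lemma norm_w_sq (L : LasserreSolution V E r) (hr : 1 ≤ r) (i : V) :
    ‖L.w i‖ ^ 2 = 1 - L.bias i ^ 2 := by
  rw [← real_inner_self_eq_norm_sq, w, inner_sub_left, inner_sub_right, inner_sub_right,
    real_inner_smul_left, real_inner_smul_left, real_inner_smul_right, real_inner_smul_right,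
    L.inner_vEmpty_self, L.inner_v_self hr, real_inner_comm (L.v i) L.vEmpty,
    L.inner_v_vEmpty hr]
  ring

lemma w_mem_gaussSpace (L : LasserreSolution V E r) (i : V) : L.w i ∈ L.gaussSpace := by
  rw [gaussSpace, Submodule.mem_orthogonal_singleton_iff_inner_left, w, inner_sub_left,
    real_inner_smul_left, L.inner_vEmpty_self]
  ring

/-- The normalized vector `w̄_i` as an element of the space of the Gaussian vector. -/
noncomputable def unitW (L : LasserreSolution V E r) (i : V) : L.gaussSpace :=
  ⟨L.wBar i, L.gaussSpace.smul_mem _ (L.w_mem_gaussSpace i)⟩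

lemma y_eq_halfspaceSign (L : LasserreSolution V E r) (i : V) :
    L.y i = halfspaceSign (L.unitW i) (PhiInv (fR (L.bias i) / 2 + 1 / 2)) := rfl

lemma norm_unitW (L : LasserreSolution V E r) {i : V} (h : L.w i ≠ 0) : ‖L.unitW i‖ = 1 := by
  change ‖‖L.w i‖⁻¹ • L.w i‖ = 1
  rw [norm_smul, norm_inv, norm_norm, inv_mul_cancel₀ (norm_ne_zero_iff.2 h)]

lemma inner_unitW (L : LasserreSolution V E r) (i j : V) :
    inner ℝ (L.unitW i) (L.unitW j) = ‖L.w i‖⁻¹ * ‖L.w j‖⁻¹ * inner ℝ (L.w i) (L.w j) := by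
  change inner ℝ (‖L.w i‖⁻¹ • L.w i) (‖L.w j‖⁻¹ • L.w j) = _
  rw [real_inner_smul_left, real_inner_smul_right]
  ring

lemma abs_inner_approx_le (L : LasserreSolution V E r) {i j : V} {τ : ℝ} (hτ : 0 < τ)
    (h : |inner ℝ (L.w i) (L.w j)| ≤ τ ^ 12) {a b : L.gaussSpace}
    (ha : a = 0 ∨ (a = L.unitW i ∧ ‖a‖ = 1 ∧ τ ^ 3 ≤ ‖L.w i‖))
    (hb : b = 0 ∨ (b = L.unitW j ∧ ‖b‖ = 1 ∧ τ ^ 3 ≤ ‖L.w j‖)) :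
    |inner ℝ a b| ≤ τ ^ 6 := by
  rcases ha with rfl | ⟨rfl, -, hi⟩
  · simp; positivity
  rcases hb with rfl | ⟨rfl, -, hj⟩
  · simp; positivity
  have hτ3 : 0 < τ ^ 3 := by positivity
  rw [inner_unitW, abs_mul, abs_of_nonneg (by positivity)]
  calc _ ≤ (τ ^ 3)⁻¹ * (τ ^ 3)⁻¹ * τ ^ 12 := by gcongr
    _ = τ ^ 6 := by field_simp

variable [FiniteDimensional ℝ E] [MeasurableSpace E] [BorelSpace E]

/-- If `‖w_i‖` is small then the rounded value is nearly deterministic. -/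
lemma exists_y_ne_const_le (L : LasserreSolution V E r) (hr : 1 ≤ r) (i : V) :
    ∃ t : EReal, (stdGaussian L.gaussSpace).real {g | L.y i g ≠ halfspaceSign 0 t g} ≤
      ‖L.w i‖ ^ 2 := by
  have hsq := L.norm_w_sq hr i
  have hnn : 0 ≤ ‖L.w i‖ ^ 2 := sq_nonneg _
  have hμ : |L.bias i| ≤ 1 := (sq_le_one_iff_abs_le_one _).1 (by linarith)
  -- Here `w̄_i = 0`, so `y_i` is itself a halfspace sign with zero normal. Otherwise the threshold
  -- `⊤` or `⊥` gives the constant favoured by the sign of `μ_i`, and the error is `(1 - fR |μ_i|) /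
  -- 2 ≤ 1 - μ_i ^ 2`.
  by_cases hw : L.w i = 0
  · refine ⟨PhiInv (fR (L.bias i) / 2 + 1 / 2), ?_⟩
    have : L.unitW i = 0 := Subtype.ext (by change ‖L.w i‖⁻¹ • L.w i = 0; simp [hw])
    rw [y_eq_halfspaceSign, this]
    simp
  have hu := L.norm_unitW hw
  rw [y_eq_halfspaceSign]
  rcases le_total 0 (L.bias i) with h | h
  · obtain ⟨h0, h1, h2⟩ := fR_bounds h ((le_abs_self _).trans hμ)
    refine ⟨⊤, ?_⟩
    have := stdGaussian_halfspaceSign_ne_one hu (p := fR (L.bias i) / 2 + 1 / 2)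
      (by linarith) (by linarith)
    have hc : ∀ g, halfspaceSign (0 : L.gaussSpace) ⊤ g = 1 := fun g => by simp [halfspaceSign]
    simp only [hc, this]
    linarith
  · obtain ⟨h0, h1, h2⟩ := fR_bounds (neg_nonneg.2 h) ((neg_le_abs _).trans hμ)
    rw [fR_neg, neg_sq] at *
    refine ⟨⊥, ?_⟩
    have := stdGaussian_halfspaceSign_ne_neg_one hu (p := fR (L.bias i) / 2 + 1 / 2)
      (by linarith) (by linarith)
    have hc : ∀ g, halfspaceSign (0 : L.gaussSpace) ⊥ g = -1 := fun g => by
      simp [halfspaceSign]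
    simp only [hc, this]
    linarith

/-- `y_i` is close to a halfspace indicator whose normal vector is zero, or is `w̄_i` when `w_i`
is not short. -/
lemma exists_halfspaceSign_approx (L : LasserreSolution V E r) (hr : 1 ≤ r) (i : V) {τ : ℝ}
    (hτ : 0 < τ) :
    ∃ (a : L.gaussSpace) (t : EReal),
      (a = 0 ∨ (a = L.unitW i ∧ ‖a‖ = 1 ∧ τ ^ 3 ≤ ‖L.w i‖)) ∧
      (stdGaussian L.gaussSpace).real {g | L.y i g ≠ halfspaceSign a t g} ≤ τ ^ 6 := by
  rcases le_total (τ ^ 3) ‖L.w i‖ with h | h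
  · have hw : L.w i ≠ 0 := norm_pos_iff.1 (lt_of_lt_of_le (by positivity) h)
    refine ⟨L.unitW i, PhiInv (fR (L.bias i) / 2 + 1 / 2),
      Or.inr ⟨rfl, L.norm_unitW hw, h⟩, ?_⟩
    rw [y_eq_halfspaceSign]
    simp only [ne_eq, not_true_eq_false, Set.ofPred_false, measureReal_empty]
    positivity
  · obtain ⟨t, ht⟩ := L.exists_y_ne_const_le hr i
    exact ⟨0, t, Or.inl rfl, ht.trans ((pow_le_pow_left₀ (norm_nonneg _) h 2).trans_eq (by ring))⟩

lemma y_ne_halfspaceSign_le (L : LasserreSolution V E r) {i : V} {τ : ℝ} (hτ : 0 < τ)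
    (hτ1 : τ ≤ 1) {a a' : L.gaussSpace} {t : EReal}
    (ha : ‖a‖ = 1 ∨ a = 0) (ha0 : a = 0 → a' = 0) (haa' : ‖a - a'‖ ≤ 3 * τ ^ 3)
    (h : (stdGaussian L.gaussSpace).real {g | L.y i g ≠ halfspaceSign a t g} ≤ τ ^ 6) :
    (stdGaussian L.gaussSpace).real {g | L.y i g ≠ halfspaceSign a' t g} ≤ 12 * τ ^ 2 := by
  -- The margin `τ ^ 2` balances the two errors: `2 * τ ^ 2` from the strip and `9 * τ ^ 6 / τ ^ 4`
  -- from Chebyshev.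
  have h1 := stdGaussian_halfspaceSign_ne_le (a := a) (a' := a') (s := τ ^ 2)
    (ha.imp_right fun h => h.trans (ha0 h).symm) t (by positivity)
  have h2 : ‖a - a'‖ ^ 2 / (τ ^ 2) ^ 2 ≤ 9 * τ ^ 2 := by
    rw [div_le_iff₀ (by positivity)]
    exact (pow_le_pow_left₀ (norm_nonneg _) haa' 2).trans_eq (by ring)
  have h3 : τ ^ 6 ≤ τ ^ 2 := pow_le_pow_of_le_one hτ.le hτ1 (by norm_num)
  linarith [measureReal_ne_trans_le (stdGaussian L.gaussSpace) (L.y i) (halfspaceSign a t)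
    (halfspaceSign a' t)]

/-- If the cross inner products of the `w`'s are small, the two products of rounded values are
nearly independent. -/
lemma abs_joint_y_sub_mul_le (L : LasserreSolution V E r) (hr : 1 ≤ r) {i₁ i₂ j₁ j₂ : V} {τ : ℝ}
    (hτ : 0 < τ) (h₁₁ : |inner ℝ (L.w i₁) (L.w j₁)| ≤ τ ^ 12)
    (h₁₂ : |inner ℝ (L.w i₁) (L.w j₂)| ≤ τ ^ 12) (h₂₁ : |inner ℝ (L.w i₂) (L.w j₁)| ≤ τ ^ 12)
    (h₂₂ : |inner ℝ (L.w i₂) (L.w j₂)| ≤ τ ^ 12) (x z : ℤˣ) :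
    |(stdGaussian L.gaussSpace).real {g | L.y i₁ g * L.y i₂ g = x ∧ L.y j₁ g * L.y j₂ g = z} -
      (stdGaussian L.gaussSpace).real {g | L.y i₁ g * L.y i₂ g = x} *
        (stdGaussian L.gaussSpace).real {g | L.y j₁ g * L.y j₂ g = z}| ≤ 144 * τ ^ 2 := by
  set P := stdGaussian L.gaussSpace with hP
  rcases le_or_gt τ 1 with hτ1 | hτ1
  swap
  -- For `τ > 1` the claimed bound exceeds 1 and is trivial.
  · have hle : ∀ S : Set L.gaussSpace, P.real S ≤ 1 := fun S => measureReal_le_one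
    have hge : ∀ S : Set L.gaussSpace, 0 ≤ P.real S := fun S => measureReal_nonneg
    exact (abs_sub_le_of_nonneg_of_le (hge _) (hle _) (mul_nonneg (hge _) (hge _))
      (mul_le_one₀ (hle _) (hge _) (hle _))).trans (by nlinarith)
  obtain ⟨a₁, s₁, ha₁, hy₁⟩ := L.exists_halfspaceSign_approx hr i₁ hτ
  obtain ⟨a₂, s₂, ha₂, hy₂⟩ := L.exists_halfspaceSign_approx hr i₂ hτ
  obtain ⟨b₁, t₁, hb₁, hz₁⟩ := L.exists_halfspaceSign_approx hr j₁ hτ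
  obtain ⟨b₂, t₂, hb₂, hz₂⟩ := L.exists_halfspaceSign_approx hr j₂ hτ
  have hunit : ∀ {i : V} {a : L.gaussSpace},
      (a = 0 ∨ (a = L.unitW i ∧ ‖a‖ = 1 ∧ τ ^ 3 ≤ ‖L.w i‖)) → ‖a‖ = 1 ∨ a = 0 :=
    fun h => h.symm.imp_left fun h => h.2.1
  have hb₂' : ‖b₂‖ ≤ 1 := by rcases hunit hb₂ with h | h <;> simp [h]
  obtain ⟨b₂', hbb, hb0, hdec⟩ := exists_near_orthogonal (hunit hb₁) hb₂' hτ hτ1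
  obtain ⟨a₁', haa₁, ha01, hor₁₁, hor₁₂⟩ := hdec a₁ (L.abs_inner_approx_le hτ h₁₁ ha₁ hb₁)
    (L.abs_inner_approx_le hτ h₁₂ ha₁ hb₂)
  obtain ⟨a₂', haa₂, ha02, hor₂₁, hor₂₂⟩ := hdec a₂ (L.abs_inner_approx_le hτ h₂₁ ha₂ hb₁)
    (L.abs_inner_approx_le hτ h₂₂ ha₂ hb₂)
  have e₁ := L.y_ne_halfspaceSign_le hτ hτ1 (hunit ha₁) ha01 haa₁ hy₁
  have e₂ := L.y_ne_halfspaceSign_le hτ hτ1 (hunit ha₂) ha02 haa₂ hy₂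
  have e₃ := L.y_ne_halfspaceSign_le hτ hτ1 (hunit hb₁) id
    (by rw [sub_self, norm_zero]; positivity) hz₁
  have e₄ := L.y_ne_halfspaceSign_le hτ hτ1 (hunit hb₂) hb0 hbb hz₂
  set U : Set L.gaussSpace :=
    ({g | L.y i₁ g ≠ halfspaceSign a₁' s₁ g} ∪ {g | L.y i₂ g ≠ halfspaceSign a₂' s₂ g}) ∪
      ({g | L.y j₁ g ≠ halfspaceSign b₁ t₁ g} ∪ {g | L.y j₂ g ≠ halfspaceSign b₂' t₂ g}) with hU
  have hUle : P.real U ≤ 48 * τ ^ 2 := by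
    refine (measureReal_union_le _ _).trans ((add_le_add (measureReal_union_le _ _)
      (measureReal_union_le _ _)).trans ?_)
    linarith
  refine (abs_joint_sub_mul_le P
    (indepFun_halfspaceSign hor₁₁ hor₁₂ hor₂₁ hor₂₂ s₁ s₂ t₁ t₂) (U := U)
    (fun g hg => ?_) (fun g hg => ?_) hUle x z).trans_eq (by ring)
  all_goals
    simp only [hU, Set.mem_union, Set.mem_ofPred_eq, not_or, not_not] at hg
    obtain ⟨⟨g₁, g₂⟩, g₃, g₄⟩ := hg
  · rw [g₁, g₂]
  · rw [g₃, g₄]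

lemma mutualInfo_y_le (L : LasserreSolution V E r) (hr : 1 ≤ r) {i₁ i₂ j₁ j₂ : V} {τ : ℝ}
    (hτ : 0 < τ) (h : |inner ℝ (L.w i₁) (L.w j₁)| + |inner ℝ (L.w i₁) (L.w j₂)| +
      |inner ℝ (L.w i₂) (L.w j₁)| + |inner ℝ (L.w i₂) (L.w j₂)| ≤ τ ^ 12) :
    mutualInfo (stdGaussian L.gaussSpace) (fun g => L.y i₁ g * L.y i₂ g)
      (fun g => L.y j₁ g * L.y j₂ g) ≤ 192 * τ := by
  have h₁ := abs_nonneg (inner ℝ (L.w i₁) (L.w j₁))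
  have h₂ := abs_nonneg (inner ℝ (L.w i₁) (L.w j₂))
  have h₃ := abs_nonneg (inner ℝ (L.w i₂) (L.w j₁))
  have h₄ := abs_nonneg (inner ℝ (L.w i₂) (L.w j₂))
  refine (mutualInfo_units_le _ _ _ (L.abs_joint_y_sub_mul_le hr hτ (by linarith) (by linarith)
    (by linarith) (by linarith))).trans_eq ?_
  rw [show 144 * τ ^ 2 = (12 * τ) ^ 2 by ring, Real.sqrt_sq (by positivity)]
  ring

end LasserreSolution

/-! ### The power bound and the main theorem -/

lemma isPolyLTOne_const_mul_rpow {C a : ℝ} (h0 : 0 < a) (h1 : a < 1) :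
    IsPolyLTOne fun x => C * x ^ a := by
  refine ⟨⟨Finsupp.single a C, fun b hb => ?_, fun x _ => ?_⟩, ?_⟩
  · rw [Finset.mem_singleton.1 (Finsupp.support_single_subset hb)]
    exact ⟨h0, h1⟩
  · exact (Finsupp.sum_single_index (h := fun b c => c * x ^ b) (zero_mul _)).symm
  · have : ContinuousAt (fun x : ℝ => C * x ^ a) 0 :=
      continuousAt_const.mul (Real.continuousAt_rpow_const 0 a (Or.inr h0.le))
    have h := this.tendsto.mono_left (nhdsWithin_le_nhds (s := Set.Ioi 0))
    simpa [Real.zero_rpow h0.ne'] using h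

end SimMaxCut

theorem mainTheorem3 :
    ∃ P : ℝ → ℝ, SimMaxCut.IsPolyLTOne P ∧
      ∀ (V : Type*) [DecidableEq V]
        (E : Type*) [NormedAddCommGroup E] [InnerProductSpace ℝ E] [FiniteDimensional ℝ E]
        [MeasurableSpace E] [BorelSpace E]
        (L : SimMaxCut.LasserreSolution V E 2) (i₁ i₂ j₁ j₂ : V) (δ : ℝ),
        |inner ℝ (L.w i₁) (L.w j₁)| + |inner ℝ (L.w i₁) (L.w j₂)| +
          |inner ℝ (L.w i₂) (L.w j₁)| + |inner ℝ (L.w i₂) (L.w j₂)| ≤ δ →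
        SimMaxCut.mutualInfo (stdGaussian L.gaussSpace)
          (fun g => L.y i₁ g * L.y i₂ g) (fun g => L.y j₁ g * L.y j₂ g) ≤ P δ := by
  refine ⟨fun x => 192 * x ^ (1 / 12 : ℝ),
    SimMaxCut.isPolyLTOne_const_mul_rpow (by norm_num) (by norm_num), ?_⟩
  intro V _ E _ _ _ _ _ L i₁ i₂ j₁ j₂ δ h
  have hδ : 0 ≤ δ := le_trans (by positivity) h
  set τ : ℝ := δ ^ (1 / 12 : ℝ) with hτ
  have hτ0 : 0 ≤ τ := Real.rpow_nonneg hδ _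
  have hpow : τ ^ 12 = δ := by
    rw [hτ, ← Real.rpow_natCast, ← Real.rpow_mul hδ]; norm_num
  -- `τ` vanishes when `δ = 0`, while the estimate needs a positive parameter; `τ + ε / 192` is used
  -- instead, at the cost of an additive `ε`.
  refine le_of_forall_pos_le_add fun ε hε => ?_
  have hle : δ ≤ (τ + ε / 192) ^ 12 := by
    rw [← hpow]; exact pow_le_pow_left₀ hτ0 (by linarith) 12
  exact (L.mutualInfo_y_le one_le_two (by positivity) (h.trans hle)).trans_eq (by ring)
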